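/- Let $0<\alpha<2$, let $\theta$ be a finite nonzero Borel measure on the unit sphere of $\mathbb{C}^2$, and let $m_\alpha$ be the measure on $(0,\infty)$ with density $\alpha r^{-(1+\alpha)}$. Let $\rho$ be the measure on $\mathbb{C}^2\setminus\{0\}$ that is $\theta\times m_\alpha$ in polar coordinates, i.e. the image of $\theta\times m_\alpha$ under $(w,r)\mapsto rw$. Let $\mathbb{N}^f=\bigcup_{k\ge 0}\mathbb{N}^k$ be the vertex set of the infinite tree in which the root is the empty word $\varnothing$ and the offspring of $v$ are $v1,v2,\dots$. Consider a realization of the Poisson weighted infinite tree $\mathbf{PWIT}(\rho)$: the point processes $\Xi_v=\{y_{v1},y_{v2},\dots\}$, $v\in\mathbb{N}^f$, are independent Poisson point processes with intensity measure $\rho$, each listed so that $\|y_{v1}\|\ge\|y_{v2}\|\ge\cdots$, and $y_{vk}=(y_{vk}^{(1)},y_{vk}^{(2)})\in\mathbb{C}^2$ is the weight of the edge $\{v,vk\}$. Put $w_{v,vk}=y^{(1)}_{vk}$, $w_{vk,v}=y^{(2)}_{vk}$ for $v\in\mathbb{N}^f$, $k\ge 1$, and $w_{uv}=0$ for all other $u,v\in\mathbb{N}^f$.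 Then, with probability one, $\sum_{v}(|w_{uv}|^2+|w_{vu}|^2)<\infty$ for every $u\in\mathbb{N}^f$, so that $\langle\delta_u,A\delta_v\rangle=w_{uv}$ defines a linear operator $A$ on the finitely supported vectors of $\ell^2(\mathbb{N}^f)$, and for all $z\in\mathbb{C}$ the bipartization $B(z)$ of $A$ is self-adjoint. Here, with $V=\mathbb{N}^f$, $\hat V=\{\hat v:v\in V\}$ a disjoint copy of $V$ and $V^b=V\cup\hat V$, $B(z)$ denotes the closure in $\ell^2(V^b)$ of the symmetric operator on the finitely supported vectors of $\ell^2(V^b)$ with $$\langle\delta_u,B(z)\delta_{\hat v}\rangle=\overline{\langle\delta_{\hat v},B(z)\delta_u\rangle}=w_{uv}-z\,\mathbf 1_{u=v},\qquad \langle\delta_u,B(z)\delta_v\rangle=\langle\delta_{\hat u},B(z)\delta_{\hat v}\rangle=0\qquad(u,v\in V).$$ -/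

import Mathlib

open MeasureTheory ProbabilityTheory
open scoped ENNReal

noncomputable section

namespace HeavyElliptic

/-! ### Poisson point processes and the Poisson weighted infinite tree -/

/-- The random measure `N` is a Poisson point process with intensity measure `ρ`: every `N(A)` is
Poisson with mean `ρ(A)` (almost surely infinite if `ρ(A) = ∞`), and the counts of pairwise disjoint
measurable sets are independent. -/
structure IsPoissonPointProcess {Ω E : Type*} [MeasurableSpace Ω] [MeasurableSpace E]
    (N : Ω → Measure E) (ρ : Measure E) (P : Measure Ω) : Prop where
  measurable : Measurable N
  law_of_lt_top : ∀ A : Set E, MeasurableSet A → ρ A < ∞ →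
    P.map (fun ω => N ω A) = (poissonMeasure (ρ A).toNNReal).map (fun n : ℕ => (n : ℝ≥0∞))
  law_of_eq_top : ∀ A : Set E, MeasurableSet A → ρ A = ∞ → ∀ᵐ ω ∂P, N ω A = ∞
  indep : ∀ (n : ℕ) (A : Fin n → Set E), (∀ i, MeasurableSet (A i)) →
    Pairwise (fun i j => Disjoint (A i) (A j)) → iIndepFun (fun i ω => N ω (A i)) P

/-- The vertex set of the infinite Ulam–Harris tree. The word `i₁ i₂ … i_k` is stored with its last
letter first, so that `[]` is the root and the offspring of `v` are `0 :: v, 1 :: v, 2 :: v, …`. -/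
abbrev Vertex : Type := List ℕ

/-- The counting measure (with multiplicities) of the points `y 0, y 1, y 2, …`. -/
def pointMeasure {E : Type*} [MeasurableSpace E] (y : ℕ → E) : Measure E :=
  Measure.sum fun k => Measure.dirac (y k)

/-- The random weights `y v k` (the weight of the edge between `v` and its offspring `k :: v`) form
a realization of the Poisson weighted infinite tree `PWIT(ρ)`: the point processes
`Ξ_v = {y v 0, y v 1, …}` are independent Poisson point processes with intensity measure `ρ`, and
the points of each of them are listed in decreasing order of their norms. -/
structure IsPWIT {Ω E : Type*} [MeasurableSpace Ω] [NormedAddCommGroup E] [MeasurableSpace E]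
    (y : Vertex → ℕ → Ω → E) (ρ : Measure E) (P : Measure Ω) : Prop where
  measurable : ∀ v k, Measurable (y v k)
  poisson : ∀ v, IsPoissonPointProcess (fun ω => pointMeasure fun k => y v k ω) ρ P
  indep : iIndepFun (fun v ω => pointMeasure fun k => y v k ω) P
  antitone : ∀ v, ∀ᵐ ω ∂P, Antitone fun k => ‖y v k ω‖

/-- The measure `m_α` on `(0, ∞)` with density `α r ^ (-(1 + α))`. -/
def mAlpha (α : ℝ) : Measure ℝ :=
  (volume.restrict (Set.Ioi (0 : ℝ))).withDensity fun r => ENNReal.ofReal (α * r ^ (-(1 + α)))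

/-- The measure `θ × m_α`, given in polar coordinates, as a measure on `ℂ²`. -/
def polarMeasure (θ : Measure (Metric.sphere (0 : EuclideanSpace ℂ (Fin 2)) 1)) (α : ℝ) :
    Measure (EuclideanSpace ℂ (Fin 2)) :=
  (θ.prod (mAlpha α)).map fun p => p.2 • (p.1 : EuclideanSpace ℂ (Fin 2))

/-! ### Operators on `ℓ²(V)` given by infinite matrices, and their bipartization -/

/-- The Hilbert space `ℓ²(V)`. -/
abbrev L2 (V : Type*) : Type _ := lp (fun _ : V => ℂ) 2

/-- The subspace `𝒟(V)` of the vectors with finite support. -/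
def finSupp (V : Type*) : Submodule ℂ (L2 V) where
  carrier := {φ | (Function.support (φ : V → ℂ)).Finite}
  add_mem' {φ ψ} hφ hψ := by
    refine Set.Finite.subset (Set.Finite.union hφ hψ) ?_
    exact Function.support_add _ _
  zero_mem' := by
    change (Function.support (fun _ : V => (0 : ℂ))).Finite
    simp
  smul_mem' c φ hφ := by
    refine Set.Finite.subset hφ ?_
    exact Function.support_const_smul_subset c _

/-- All columns of the infinite matrix `W` are square summable. -/
def ColumnsL2 {V : Type*} (W : Matrix V V ℂ) : Prop :=
  ∀ v, Memℓp (fun u => W u v) 2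

/-- All rows and all columns of the infinite matrix `W` are square summable. -/
def RowsColumnsL2 {V : Type*} (W : Matrix V V ℂ) : Prop :=
  ∀ u, Summable fun v => ‖W u v‖ ^ 2 + ‖W v u‖ ^ 2

/-- The linear operator with domain `𝒟(V)` and `⟨δ_u, A δ_v⟩ = W u v`. -/
def matrixOp {V : Type*} (W : Matrix V V ℂ) (h : ColumnsL2 W) : L2 V →ₗ.[ℂ] L2 V where
  domain := finSupp V
  toFun :=
    { toFun := fun φ => ∑ᶠ v, (φ : L2 V) v • (⟨fun u => W u v, h v⟩ : L2 V)
      map_add' := fun φ ψ => by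
        rw [← finsum_add_distrib]
        · simp [add_smul]
        · exact Set.Finite.subset φ.2 fun v hv h0 => hv (by
            change (φ : L2 V) v • _ = (0 : L2 V)
            rw [h0, zero_smul])
        · exact Set.Finite.subset ψ.2 fun v hv h0 => hv (by
            change (ψ : L2 V) v • _ = (0 : L2 V)
            rw [h0, zero_smul])
      map_smul' := fun c φ => by
        rw [RingHom.id_apply, smul_finsum]
        simp [mul_smul] }

/-- The matrix of the bipartization `B(z) = B - U(z, 0) ⊗ I_V`, where `W` is the matrix of the
operator that is bipartized. The index set is `V ⊕ V`; its right summand is the copy of `V`. -/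
def bipartMatrix {V : Type*} [DecidableEq V] (W : Matrix V V ℂ) (z : ℂ) :
    Matrix (V ⊕ V) (V ⊕ V) ℂ :=
  Matrix.fromBlocks 0 W W.conjTranspose 0 -
    Matrix.fromBlocks 0 (z • (1 : Matrix V V ℂ)) (star z • (1 : Matrix V V ℂ)) 0

theorem columnsL2_bipartMatrix {V : Type*} [DecidableEq V] {W : Matrix V V ℂ}
    (h : RowsColumnsL2 W) (z : ℂ) : ColumnsL2 (bipartMatrix W z) := by
  have key : ∀ (c : ℂ) (v : V) (f : V → ℂ), Summable (fun u => ‖f u‖ ^ 2) →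
      Summable fun u => ‖f u - c * (1 : Matrix V V ℂ) u v‖ ^ 2 := by
    intro c v f hf
    refine (summable_congr_cofinite ?_).1 hf
    filter_upwards [(Set.finite_singleton v).compl_mem_cofinite] with u hu
    have : u ≠ v := hu
    simp [Matrix.one_apply_ne this]
  have hrow : ∀ u, Summable fun v => ‖W u v‖ ^ 2 := fun u =>
    Summable.of_nonneg_of_le (fun _ => by positivity)
      (fun v => le_add_of_nonneg_right (by positivity)) (h u)
  have hcol : ∀ u, Summable fun v => ‖W v u‖ ^ 2 := fun u =>
    Summable.of_nonneg_of_le (fun _ => by positivity)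
      (fun v => le_add_of_nonneg_left (by positivity)) (h u)
  intro x
  refine memℓp_gen ?_
  simp only [ENNReal.toReal_ofNat, Real.rpow_ofNat]
  refine (Equiv.sumComm V V).summable_iff.1 ?_
  rcases x with v | v
  · refine (Summable.hasSum ?_).sum (Summable.hasSum ?_) |>.summable
    · have := key (star z) v (fun u => star (W v u)) (by simpa using hrow v)
      simpa [bipartMatrix, Function.comp_def] using this
    · simp [bipartMatrix, Function.comp_def]
  · refine (Summable.hasSum ?_).sum (Summable.hasSum ?_) |>.summable
    · simp [bipartMatrix, Function.comp_def]
    · have := key z v (fun u => W u v) (hcol v)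
      simpa [bipartMatrix, Function.comp_def] using this

/-- The bipartization `B(z)` of the operator with matrix `W`: the closure of the operator on
`𝒟(V ⊕ V)` with matrix `bipartMatrix W z`. -/
def bipartization {V : Type*} [DecidableEq V] (W : Matrix V V ℂ) (h : RowsColumnsL2 W) (z : ℂ) :
    L2 (V ⊕ V) →ₗ.[ℂ] L2 (V ⊕ V) :=
  (matrixOp (bipartMatrix W z) (columnsL2_bipartMatrix h z)).closure

/-! ### The limit operator -/

/-- The matrix of the operator `A` associated with edge weights `y` in `ℂ²`: its entry at
`(v, k :: v)` is the first coordinate of `y v k`, its entry at `(k :: v, v)` is the second one, and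
all other entries vanish. -/
def limitMatrix (y : Vertex → ℕ → EuclideanSpace ℂ (Fin 2)) : Matrix Vertex Vertex ℂ :=
  fun u v =>
    (match v with
      | [] => 0
      | k :: p => if p = u then y p k 0 else 0) +
    (match u with
      | [] => 0
      | k :: p => if p = v then y p k 1 else 0)

end HeavyElliptic

end

/-! Self-adjointness can only fail through mass escaping to infinity, so it suffices to find finite
sets `S` exhausting the tree whose boundary is crossed by uniformly small weights. Let `T` be the
finitely supported operator. For `φ`, `ψ` in the domain of `T*`, truncation to `S` reduces the
defect of symmetry of `T*` to the boundary terms `⟨φ - φ_S, T ψ_S⟩` and `⟨ψ - ψ_S, T φ_S⟩`. On a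
tree, if `S` is closed under parents, a vertex outside `S` has at most one neighbour in `S`. Hence
the part of `T` leading out of `S` has norm at most `√κ`, where `κ` bounds the sum of squared
weights leaving `S` at any one vertex. As `‖φ - φ_S‖ → 0`, the boundary terms vanish in the limit
(`isSelfAdjoint_closure_matrixOp`).

Such sets come from a subcritical branching process. With `f k = R (k+1)^(-1/α)`, square summable
because `α < 2`, keep the edge from `v` to its offspring `k` when `Ξ_v` has at least `k + 1` points
of norm above `f k`. Since the points are listed by decreasing norm, an edge that is not kept has
weight at most `f k`. For `R` large, a Poisson tail bound makes the probability of keeping it at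
most `3^(-(k+1))`. The mean number of kept offspring is thus at most `1/2`, and by independence of
the `Ξ_v` all clusters of kept edges are almost surely finite (`ae_finite_keptPath`). Finite unions
of clusters, filled up towards the root, then serve as `S`, with `κ = ∑ f k ^ 2`
(`selfAdjoint_of_finite_clusters`). -/

namespace HeavyElliptic

open Filter Topology LinearPMap

/-! ### Essential self-adjointness -/

/-- The adjoint of a graph is its orthogonal complement up to the rotation `(a, b) ↦ (b, -a)`, so
taking it twice gives the double orthogonal complement, which is the closure. Orthogonality needs
the Hilbert norm on the product, hence `WithLp 2`. -/
theorem mem_topologicalClosure_of_mem_adjoint_adjoint {E F : Type*} [NormedAddCommGroup E]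
    [InnerProductSpace ℂ E] [NormedAddCommGroup F] [InnerProductSpace ℂ F] [CompleteSpace E]
    [CompleteSpace F] (g : Submodule ℂ (E × F)) {x : E × F} (hx : x ∈ g.adjoint.adjoint) :
    x ∈ g.topologicalClosure := by
  let e := WithLp.prodContinuousLinearEquiv 2 ℂ E F
  let G : Submodule ℂ (WithLp 2 (E × F)) := g.comap e.toLinearMap
  have hG : e.symm x ∈ Gᗮᗮ := by
    rw [Submodule.mem_orthogonal]
    intro u hu
    rw [Submodule.mem_orthogonal] at hu
    have h1 : (u.snd, -u.fst) ∈ g.adjoint := by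
      rw [Submodule.mem_adjoint_iff]
      intro a b hab
      have := hu (WithLp.toLp 2 (a, b)) hab
      rw [WithLp.prod_inner_apply] at this
      simp only [inner_neg_right, sub_neg_eq_add]
      rw [add_comm]
      exact this
    have h2 := (Submodule.mem_adjoint_iff _ _).1 hx _ _ h1
    rw [WithLp.prod_inner_apply]
    simp only [inner_neg_left] at h2
    have h3 : inner ℂ u.fst x.1 + inner ℂ u.snd x.2 = 0 := by linear_combination -h2
    exact h3
  rw [Submodule.orthogonal_orthogonal_eq_closure] at hG
  have hG' : e.symm x ∈ closure (e ⁻¹' (g : Set (E × F))) := hG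
  have h4 : e.symm x ∈ e ⁻¹' closure (g : Set (E × F)) :=
    (e.toHomeomorph.preimage_closure (g : Set (E × F))) ▸ hG'
  have h5 : x ∈ closure (g : Set (E × F)) := by simpa using h4
  exact h5

/-- A densely defined symmetric operator with symmetric adjoint is essentially self-adjoint. -/
theorem isSelfAdjoint_closure_of_adjoint {E : Type*} [NormedAddCommGroup E]
    [InnerProductSpace ℂ E] [CompleteSpace E] {T : E →ₗ.[ℂ] E} (hT : Dense (T.domain : Set E))
    (hs : T.IsFormalAdjoint T) (ha : T.adjoint.IsFormalAdjoint T.adjoint) :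
    IsSelfAdjoint T.closure := by
  have hle : T ≤ T.adjoint := hs.le_adjoint hT
  have hcl : T.adjoint.IsClosed := adjoint_isClosed hT
  have hc : T.IsClosable := hcl.isClosable.leIsClosable hle
  have hdense : Dense (T.closure.domain : Set E) := hT.mono T.le_closure.1
  rw [LinearPMap.isSelfAdjoint_def]
  apply LinearPMap.eq_of_eq_graph
  rw [LinearPMap.adjoint_graph_eq_graph_adjoint hdense, ← hc.graph_closure_eq_closure_graph]
  apply le_antisymm
  -- With `Γ` the graph of `T`: an element of the adjoint of `closure Γ` lies in the graph of `T*`.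
  -- Symmetry of `T*` puts it in the double adjoint of `Γ`, that is, in `closure Γ`.
  · intro x hx
    apply mem_topologicalClosure_of_mem_adjoint_adjoint
    have hx' : x ∈ T.adjoint.graph := by
      rw [LinearPMap.adjoint_graph_eq_graph_adjoint hT]
      rw [Submodule.mem_adjoint_iff] at hx ⊢
      exact fun a b hab => hx a b (Submodule.le_topologicalClosure _ hab)
    rw [← LinearPMap.adjoint_graph_eq_graph_adjoint hT, Submodule.mem_adjoint_iff]
    intro a b hab
    rw [LinearPMap.mem_graph_iff] at hab hx'
    obtain ⟨p, rfl, rfl⟩ := hab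
    obtain ⟨q, hq, hq'⟩ := hx'
    rw [← hq, ← hq', ha p q, sub_self]
  -- Conversely, `closure Γ` is contained in the closed graph of `T*`, on which the form is
  -- symmetric.
  · intro x hx
    have h1 : T.graph.topologicalClosure ≤ T.adjoint.graph :=
      Submodule.topologicalClosure_minimal _ (LinearPMap.le_graph_of_le hle) hcl
    have hx' := h1 hx
    rw [Submodule.mem_adjoint_iff]
    intro a b hab
    have hab' := h1 hab
    rw [LinearPMap.mem_graph_iff] at hab' hx'
    obtain ⟨p, hp, hp'⟩ := hab'
    obtain ⟨q, hq, hq'⟩ := hx'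
    change (p : E) = a at hp
    change T.adjoint p = b at hp'
    rw [← hq, ← hq', ← hp, ← hp', ha p q, sub_self]

/-! ### Operators given by infinite Hermitian matrices -/

section MatrixOp

variable {X : Type*}

theorem coe_sum_apply {ι : Type*} (s : Finset ι) (f : ι → L2 X) (x : X) :
    (∑ i ∈ s, f i : L2 X) x = ∑ i ∈ s, f i x := by
  classical
  induction s using Finset.induction_on with
  | empty => rfl
  | insert a s ha ih =>
    rw [Finset.sum_insert ha, Finset.sum_insert ha, ← ih]
    rfl

theorem matrixOp_apply_apply {M : Matrix X X ℂ} (hc : ColumnsL2 M) (φ : (matrixOp M hc).domain)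
    {S : Finset X} (hS : Function.support ((φ : L2 X) : X → ℂ) ⊆ S) (u : X) :
    (matrixOp M hc φ) u = ∑ v ∈ S, (φ : L2 X) v * M u v := by
  have : matrixOp M hc φ = ∑ v ∈ S, (φ : L2 X) v • (⟨fun u => M u v, hc v⟩ : L2 X) := by
    refine finsum_eq_sum_of_support_subset _ fun v hv => hS fun h0 => hv ?_
    change (φ : L2 X) v • _ = (0 : L2 X)
    rw [h0, zero_smul]
  rw [this, coe_sum_apply]
  rfl

variable [DecidableEq X]

/-- The restriction of an `ℓ²` vector to a finite set. -/
noncomputable def truncate (S : Finset X) (φ : L2 X) : L2 X := ∑ x ∈ S, lp.single 2 x (φ x)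

theorem truncate_apply (S : Finset X) (φ : L2 X) (x : X) :
    truncate S φ x = if x ∈ S then φ x else 0 := by
  rw [truncate, coe_sum_apply]
  simp [Pi.single_apply]

theorem truncate_mem_finSupp (S : Finset X) (φ : L2 X) : truncate S φ ∈ finSupp X := by
  refine S.finite_toSet.subset fun x hx => ?_
  by_contra h
  exact hx (by rw [truncate_apply, if_neg (by simpa using h)])

theorem truncate_eq_self {S : Finset X} {φ : L2 X} (h : Function.support (φ : X → ℂ) ⊆ S) :
    truncate S φ = φ := by
  ext x
  rw [truncate_apply]
  split_ifs with hx
  · rfl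
  · by_contra h0
    exact hx (h (Ne.symm h0))

theorem tendsto_truncate (φ : L2 X) :
    Tendsto (fun S => truncate S φ) atTop (𝓝 φ) :=
  lp.hasSum_single (by norm_num) φ

theorem dense_finSupp : Dense (finSupp X : Set (L2 X)) := fun φ =>
  mem_closure_of_tendsto (tendsto_truncate φ) (Eventually.of_forall fun S =>
    truncate_mem_finSupp S φ)

theorem inner_truncate_left (S : Finset X) (φ ψ : L2 X) :
    inner ℂ (truncate S φ) ψ = ∑ x ∈ S, inner ℂ (φ x) (ψ x) := by
  simp only [truncate, sum_inner, lp.inner_single_left]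

theorem inner_truncate_right (S : Finset X) (φ ψ : L2 X) :
    inner ℂ φ (truncate S ψ) = ∑ x ∈ S, inner ℂ (φ x) (ψ x) := by
  simp only [truncate, inner_sum, lp.inner_single_right]

variable {M : Matrix X X ℂ} (hc : ColumnsL2 M)

theorem matrixOp_isFormalAdjoint (hM : M.IsHermitian) :
    (matrixOp M hc).IsFormalAdjoint (matrixOp M hc) := by
  intro φ ψ
  obtain ⟨S, hS₁, hS₂⟩ : ∃ S : Finset X, Function.support ((φ : L2 X) : X → ℂ) ⊆ S ∧
      Function.support ((ψ : L2 X) : X → ℂ) ⊆ S := by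
    refine ⟨(φ.2.union ψ.2).toFinset, ?_, ?_⟩
    · simp
    · simp
  have h1 := inner_truncate_right S (matrixOp M hc φ) ψ
  have h2 := inner_truncate_left S φ (matrixOp M hc ψ)
  rw [truncate_eq_self hS₂] at h1
  rw [truncate_eq_self hS₁] at h2
  rw [h1, h2]
  simp only [matrixOp_apply_apply hc _ hS₁, matrixOp_apply_apply hc _ hS₂, sum_inner, inner_sum]
  rw [Finset.sum_comm]
  refine Finset.sum_congr rfl fun u _ => Finset.sum_congr rfl fun v _ => ?_
  have := hM.apply u v
  simp only [RCLike.inner_apply, map_mul]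
  rw [← this, starRingEnd_apply, starRingEnd_apply]
  ring

/-- The part of `M` that maps vectors on `S` to vectors off `S` has norm at most `√κ`. -/
theorem norm_sub_truncate_matrixOp_le {S : Finset X} {κ : ℝ} (hκ : 0 ≤ κ)
    (hrow : ∀ u ∉ S, ∀ v ∈ S, ∀ v' ∈ S, M u v ≠ 0 → M u v' ≠ 0 → v = v')
    (hcol : ∀ v ∈ S, ∑' u, (if u ∈ S then 0 else ‖M u v‖ ^ 2) ≤ κ) (ψ : L2 X) :
    ‖matrixOp M hc ⟨truncate S ψ, truncate_mem_finSupp S ψ⟩ -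
      truncate S (matrixOp M hc ⟨truncate S ψ, truncate_mem_finSupp S ψ⟩)‖ ≤ √κ * ‖ψ‖ := by
  set g := matrixOp M hc ⟨truncate S ψ, truncate_mem_finSupp S ψ⟩
  have hg : ∀ u, g u = ∑ v ∈ S, ψ v * M u v := by
    intro u
    refine (matrixOp_apply_apply hc ⟨truncate S ψ, truncate_mem_finSupp S ψ⟩ (S := S)
      (fun x hx => ?_) u).trans (Finset.sum_congr rfl fun v hv => ?_)
    · by_contra h
      exact hx (by rw [truncate_apply, if_neg (by simpa using h)])
    · rw [truncate_apply, if_pos hv]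
  have hsum : ∀ v, Summable fun u => (if u ∈ S then 0 else ‖M u v‖ ^ 2) := by
    intro v
    have h := (hc v).summable (by norm_num)
    simp only [ENNReal.toReal_ofNat, Real.rpow_ofNat] at h
    refine h.of_nonneg_of_le (fun u => ?_) fun u => ?_
    · split_ifs <;> positivity
    · split_ifs
      · positivity
      · exact le_rfl
  -- By `hrow`, the sum defining `g u` for `u ∉ S` has at most one nonzero term, so its square
  -- produces no cross terms.
  have hb : ∀ u, ‖(g - truncate S g : L2 X) u‖ ^ 2 ≤
      ∑ v ∈ S, ‖ψ v‖ ^ 2 * (if u ∈ S then 0 else ‖M u v‖ ^ 2) := by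
    intro u
    have : (g - truncate S g : L2 X) u = g u - truncate S g u := rfl
    rw [this, truncate_apply]
    by_cases hu : u ∈ S
    · simp [hu]
    · simp only [hu, if_false, sub_zero]
      rw [hg u]
      by_cases h0 : ∃ v ∈ S, M u v ≠ 0
      · obtain ⟨v, hv, hv0⟩ := h0
        rw [Finset.sum_eq_single_of_mem v hv, norm_mul, mul_pow]
        · exact Finset.single_le_sum (f := fun v => ‖ψ v‖ ^ 2 * ‖M u v‖ ^ 2)
            (fun _ _ => by positivity) hv
        · intro v' hv' hne
          by_contra h
          exact hne (hrow u hu v' hv' v hv (fun h' => h (by rw [h', mul_zero])) hv0)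
      · push Not at h0
        rw [Finset.sum_eq_zero fun v hv => by rw [h0 v hv, mul_zero]]
        rw [norm_zero, zero_pow two_ne_zero]
        exact Finset.sum_nonneg fun v _ => by positivity
  refine lp.norm_le_of_tsum_le (by norm_num) (by positivity) ?_
  simp only [ENNReal.toReal_ofNat, Real.rpow_ofNat]
  have hsum' : Summable fun u => ∑ v ∈ S, ‖ψ v‖ ^ 2 * (if u ∈ S then 0 else ‖M u v‖ ^ 2) :=
    summable_sum fun v _ => (hsum v).mul_left _
  calc ∑' u, ‖(g - truncate S g : L2 X) u‖ ^ 2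
      ≤ ∑' u, ∑ v ∈ S, ‖ψ v‖ ^ 2 * (if u ∈ S then 0 else ‖M u v‖ ^ 2) :=
        (hsum'.of_nonneg_of_le (fun _ => by positivity) hb).tsum_le_tsum hb hsum'
    _ = ∑ v ∈ S, ‖ψ v‖ ^ 2 * ∑' u, (if u ∈ S then 0 else ‖M u v‖ ^ 2) := by
        rw [Summable.tsum_finsetSum fun v _ => (hsum v).mul_left _]
        simp only [tsum_mul_left]
    _ ≤ ∑ v ∈ S, ‖ψ v‖ ^ 2 * κ := by
        gcongr with v hv
        exact hcol v hv
    _ = κ * ∑ v ∈ S, ‖ψ v‖ ^ 2 := by rw [← Finset.sum_mul, mul_comm]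
    _ ≤ κ * ‖ψ‖ ^ 2 := by
        have := lp.sum_rpow_le_norm_rpow (p := 2) (by norm_num) ψ S
        simp only [ENNReal.toReal_ofNat, Real.rpow_ofNat] at this
        gcongr
    _ = (√κ * ‖ψ‖) ^ 2 := by rw [mul_pow, Real.sq_sqrt hκ]

/-- Since `φ - truncate S φ` vanishes on `S`, only the part of the image lying off `S` contributes.
Keeping the factor `‖φ - truncate S φ‖` is what makes the boundary terms tend to zero. -/
theorem norm_inner_sub_truncate_le {S : Finset X} {κ : ℝ} (hκ : 0 ≤ κ)
    (hrow : ∀ u ∉ S, ∀ v ∈ S, ∀ v' ∈ S, M u v ≠ 0 → M u v' ≠ 0 → v = v')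
    (hcol : ∀ v ∈ S, ∑' u, (if u ∈ S then 0 else ‖M u v‖ ^ 2) ≤ κ) (φ ψ : L2 X) :
    ‖inner ℂ (φ - truncate S φ) (matrixOp M hc ⟨truncate S ψ, truncate_mem_finSupp S ψ⟩)‖ ≤
      ‖φ - truncate S φ‖ * (√κ * ‖ψ‖) := by
  have h := norm_sub_truncate_matrixOp_le hc hκ hrow hcol ψ
  set g := matrixOp M hc ⟨truncate S ψ, truncate_mem_finSupp S ψ⟩
  have h0 : inner ℂ (φ - truncate S φ) (truncate S g) = 0 := by
    rw [inner_truncate_right]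
    refine Finset.sum_eq_zero fun x hx => ?_
    have : (φ - truncate S φ : L2 X) x = φ x - truncate S φ x := rfl
    rw [this, truncate_apply, if_pos hx, sub_self, inner_zero_left]
  have h1 : inner ℂ (φ - truncate S φ) g = inner ℂ (φ - truncate S φ) (g - truncate S g) := by
    rw [inner_sub_right, h0, sub_zero]
  rw [h1]
  exact (norm_inner_le_norm _ _).trans (by gcongr)

/-- A Hermitian matrix defines an essentially self-adjoint operator if there are arbitrarily large
finite sets `S i` across whose boundary the matrix is uniformly bounded and tree-like. -/
theorem isSelfAdjoint_closure_matrixOp {ι : Type*} {l : Filter ι} [l.NeBot] (hM : M.IsHermitian)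
    {S : ι → Finset X} (hS : Tendsto S l atTop) {κ : ℝ} (hκ : 0 ≤ κ)
    (hrow : ∀ i, ∀ u ∉ S i, ∀ v ∈ S i, ∀ v' ∈ S i, M u v ≠ 0 → M u v' ≠ 0 → v = v')
    (hcol : ∀ i, ∀ v ∈ S i, ∑' u, (if u ∈ S i then 0 else ‖M u v‖ ^ 2) ≤ κ) :
    IsSelfAdjoint (matrixOp M hc).closure := by
  have hd : Dense ((matrixOp M hc).domain : Set (L2 X)) := dense_finSupp
  refine isSelfAdjoint_closure_of_adjoint hd (matrixOp_isFormalAdjoint hc hM) ?_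
  let T := matrixOp M hc
  change T.adjoint.IsFormalAdjoint T.adjoint
  intro φ ψ
  let p : ι → L2 X → T.domain := fun i χ => ⟨truncate (S i) χ, truncate_mem_finSupp _ χ⟩
  have hp : ∀ χ : L2 X, Tendsto (fun i => (p i χ : L2 X)) l (𝓝 χ) := fun χ =>
    (tendsto_truncate χ).comp hS
  have hadj := adjoint_isFormalAdjoint hd
  have hdecay : ∀ χ η : L2 X,
      Tendsto (fun i => inner ℂ (χ - (p i χ : L2 X)) (T (p i η))) l (𝓝 0) := by
    intro χ η
    have h1 : Tendsto (fun i => ‖χ - (p i χ : L2 X)‖ * (√κ * ‖η‖)) l (𝓝 0) := by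
      have := ((tendsto_const_nhds (x := χ)).sub (hp χ)).norm.mul_const (√κ * ‖η‖)
      simpa using this
    exact squeeze_zero_norm
      (fun i => norm_inner_sub_truncate_le hc hκ (hrow i) (hcol i) χ η) h1
  have hlim₁ : Tendsto (fun i => inner ℂ (T.adjoint φ) (p i ψ : L2 X)) l
      (𝓝 (inner ℂ (T.adjoint φ) (ψ : L2 X))) := tendsto_const_nhds.inner (hp ψ)
  have hlim₂ : Tendsto (fun i => inner ℂ (p i φ : L2 X) (T.adjoint ψ)) l
      (𝓝 (inner ℂ (φ : L2 X) (T.adjoint ψ))) := (hp φ).inner tendsto_const_nhds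
  -- A Green formula: moving `T*` onto the truncations and cancelling `⟨T φ_S, ψ_S⟩ = ⟨φ_S, T ψ_S⟩`
  -- leaves exactly the two boundary terms controlled by `hdecay`.
  have hdiff : Tendsto (fun i => inner ℂ (T.adjoint φ) (p i ψ : L2 X) -
      inner ℂ (p i φ : L2 X) (T.adjoint ψ)) l (𝓝 0) := by
    have hlim := (hdecay φ ψ).sub ((Complex.continuous_conj.tendsto _).comp (hdecay ψ φ))
    rw [_root_.map_zero, sub_zero] at hlim
    refine hlim.congr fun i => ?_
    have hs : inner ℂ (T (p i φ)) (p i ψ : L2 X) = inner ℂ (p i φ : L2 X) (T (p i ψ)) :=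
      matrixOp_isFormalAdjoint hc hM (p i φ) (p i ψ)
    have h1 : inner ℂ (T.adjoint φ) (p i ψ : L2 X) = inner ℂ (φ : L2 X) (T (p i ψ)) :=
      hadj φ (p i ψ)
    have h2 : inner ℂ (T (p i φ)) (ψ : L2 X) = inner ℂ (p i φ : L2 X) (T.adjoint ψ) :=
      hadj.symm (p i φ) ψ
    rw [h1, ← h2, Function.comp_apply, inner_conj_symm, inner_sub_left, inner_sub_right, hs]
    ring
  exact sub_eq_zero.1 (tendsto_nhds_unique (hlim₁.sub hlim₂) hdiff)

end MatrixOp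

/-! ### The limit matrix on the tree -/

theorem bipartMatrix_isHermitian {V : Type*} [DecidableEq V] (W : Matrix V V ℂ) (z : ℂ) :
    (bipartMatrix W z).IsHermitian := by
  unfold bipartMatrix Matrix.IsHermitian
  simp [Matrix.fromBlocks_conjTranspose]

theorem limitMatrix_cons_right (y : Vertex → ℕ → EuclideanSpace ℂ (Fin 2)) (v : Vertex) (k : ℕ) :
    limitMatrix y v (k :: v) = y v k 0 := by
  rcases v with _ | ⟨j, p⟩
  · simp [limitMatrix]
  · have : p ≠ k :: j :: p := fun h => by
      have := congrArg List.length h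
      simp only [List.length_cons] at this
      omega
    simp [limitMatrix, this]

theorem limitMatrix_cons_left (y : Vertex → ℕ → EuclideanSpace ℂ (Fin 2)) (v : Vertex) (k : ℕ) :
    limitMatrix y (k :: v) v = y v k 1 := by
  rcases v with _ | ⟨j, p⟩
  · simp [limitMatrix]
  · have : p ≠ k :: j :: p := fun h => by
      have := congrArg List.length h
      simp only [List.length_cons] at this
      omega
    simp [limitMatrix, this]

/-- Nonzero entries of the limit matrix only occur between a vertex and its parent. -/
theorem exists_cons_of_limitMatrix_ne_zero {y : Vertex → ℕ → EuclideanSpace ℂ (Fin 2)}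
    {u v : Vertex} (h : limitMatrix y u v ≠ 0) : (∃ k, v = k :: u) ∨ ∃ k, u = k :: v := by
  by_contra hn
  push Not at hn
  refine h ?_
  rcases u with _ | ⟨j, p⟩ <;> rcases v with _ | ⟨k, q⟩
  · simp [limitMatrix]
  · have : q ≠ [] := fun h => hn.1 k (by rw [h])
    simp [limitMatrix, this]
  · have : p ≠ [] := fun h => hn.2 j (by rw [h])
    simp [limitMatrix, this]
  · have h1 : q ≠ j :: p := fun h => hn.1 k (by rw [h])
    have h2 : p ≠ k :: q := fun h => hn.2 j (by rw [h])
    simp [limitMatrix, h1, h2]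

theorem norm_sq_eq_add (x : EuclideanSpace ℂ (Fin 2)) : ‖x‖ ^ 2 = ‖x 0‖ ^ 2 + ‖x 1‖ ^ 2 := by
  rw [EuclideanSpace.norm_sq_eq, Fin.sum_univ_two]

theorem rowsColumnsL2_limitMatrix {y : Vertex → ℕ → EuclideanSpace ℂ (Fin 2)}
    (h : ∀ v, Summable fun k => ‖y v k‖ ^ 2) : RowsColumnsL2 (limitMatrix y) := by
  intro u
  have hinj : Function.Injective fun k : ℕ => k :: u := fun a b hab => by simpa using hab
  let f : Vertex → ℝ := fun v => ‖limitMatrix y u v‖ ^ 2 + ‖limitMatrix y v u‖ ^ 2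
  have hf : Summable (Set.indicator (Set.range fun k : ℕ => k :: u) f) := by
    rw [← hinj.summable_iff fun x hx => Set.indicator_of_notMem hx f]
    refine (h u).congr fun k => ?_
    rw [Function.comp_apply, Set.indicator_of_mem (Set.mem_range_self k)]
    simp only [f, limitMatrix_cons_right, limitMatrix_cons_left, norm_sq_eq_add]
  -- Off the offspring of `u` the entries vanish, except possibly at the parent `u.tail`; one term
  -- does not affect summability.
  refine (summable_congr_cofinite ?_).1 hf
  filter_upwards [(Set.finite_singleton u.tail).compl_mem_cofinite] with v hv
  by_cases hr : v ∈ Set.range fun k : ℕ => k :: u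
  · rw [Set.indicator_of_mem hr]
  · rw [Set.indicator_of_notMem hr]
    have h1 : ¬ ∃ k, v = k :: u := fun ⟨k, hk⟩ => hr ⟨k, hk.symm⟩
    have h2 : ¬ ∃ k, u = k :: v := fun ⟨k, hk⟩ => hv (by simp [hk])
    have h3 : limitMatrix y u v = 0 := by
      by_contra h0
      exact (exists_cons_of_limitMatrix_ne_zero h0).elim h1 h2
    have h4 : limitMatrix y v u = 0 := by
      by_contra h0
      exact (exists_cons_of_limitMatrix_ne_zero h0).elim h2 h1
    simp [h3, h4]

/-- The bipartization is self-adjoint if there are arbitrarily large finite subtrees `S i`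
containing the root such that the squared weights of the edges leaving `S i` at any given vertex
have a bounded sum. -/
theorem isSelfAdjoint_bipartization_limitMatrix {y : Vertex → ℕ → EuclideanSpace ℂ (Fin 2)}
    {ι : Type*} {l : Filter ι} [l.NeBot] {S : ι → Finset Vertex} (hS : Tendsto S l atTop)
    (hparent : ∀ i k v, k :: v ∈ S i → v ∈ S i) (hsum : ∀ v, Summable fun k => ‖y v k‖ ^ 2)
    {κ : ℝ} (hκ : 0 ≤ κ)
    (hcut : ∀ i, ∀ v ∈ S i, ∑' k, (if k :: v ∈ S i then 0 else ‖y v k‖ ^ 2) ≤ κ)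
    (h : RowsColumnsL2 (limitMatrix y)) (z : ℂ) :
    IsSelfAdjoint (bipartization (limitMatrix y) h z) := by
  have hchild : ∀ i, ∀ u ∉ S i, ∀ v ∈ S i,
      limitMatrix y u v ≠ 0 ∨ limitMatrix y v u ≠ 0 → ∃ k, u = k :: v := by
    intro i u hu v hv hne
    have h1 : ¬ ∃ k, v = k :: u := fun ⟨k, hk⟩ => hu (hparent i k u (hk ▸ hv))
    rcases hne with hne | hne
    · exact (exists_cons_of_limitMatrix_ne_zero hne).resolve_left h1
    · exact (exists_cons_of_limitMatrix_ne_zero hne).resolve_right h1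
  -- The shift by `z` joins `u` only to its own copy. With the same set `S i` used in both copies it
  -- never crosses the boundary, so the bound does not depend on `z`.
  have hrl : ∀ u v, u ≠ v → bipartMatrix (limitMatrix y) z (.inl u) (.inr v) =
      limitMatrix y u v := by
    intro u v huv
    simp [bipartMatrix, Matrix.one_apply_ne huv]
  have hlr : ∀ u v, u ≠ v → bipartMatrix (limitMatrix y) z (.inr u) (.inl v) =
      star (limitMatrix y v u) := by
    intro u v huv
    simp [bipartMatrix, Matrix.one_apply_ne huv]
  have hll : ∀ u v, bipartMatrix (limitMatrix y) z (.inl u) (.inl v) = 0 := by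
    intro u v
    simp [bipartMatrix]
  have hrr : ∀ u v, bipartMatrix (limitMatrix y) z (.inr u) (.inr v) = 0 := by
    intro u v
    simp [bipartMatrix]
  have hne : ∀ i, ∀ u ∉ S i, ∀ v ∈ S i, u ≠ v := fun i u hu v hv huv => hu (huv ▸ hv)
  have hcutsum : ∀ i v, Summable fun k => (if k :: v ∈ S i then 0 else ‖y v k‖ ^ 2) := by
    intro i v
    refine (hsum v).of_nonneg_of_le (fun k => ?_) fun k => ?_
    · split_ifs <;> positivity
    · split_ifs
      · positivity
      · exact le_rfl
  have hbound : ∀ i, ∀ v ∈ S i, ∀ j : Fin 2,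
      ∑' k, (if k :: v ∈ S i then 0 else ‖y v k j‖ ^ 2) ≤ κ := by
    intro i v hv j
    have hle : ∀ k, (if k :: v ∈ S i then 0 else ‖y v k j‖ ^ 2) ≤
        (if k :: v ∈ S i then 0 else ‖y v k‖ ^ 2) := by
      intro k
      split_ifs
      · exact le_rfl
      · exact pow_le_pow_left₀ (norm_nonneg _) (PiLp.norm_apply_le _ j) 2
    refine le_trans (Summable.tsum_le_tsum hle ?_ (hcutsum i v)) (hcut i v hv)
    exact (hcutsum i v).of_nonneg_of_le (fun k => by split_ifs <;> positivity) hle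
  refine isSelfAdjoint_closure_matrixOp (S := fun i => (S i).disjSum (S i)) _
    (bipartMatrix_isHermitian _ z) (l := l) ?_ hκ ?_ ?_
  · refine tendsto_atTop.2 fun F => ?_
    filter_upwards [tendsto_atTop.1 hS (F.toLeft ∪ F.toRight)] with i hi x hx
    rcases x with v | v
    · exact Finset.inl_mem_disjSum.2 (hi (Finset.mem_union_left _ (Finset.mem_toLeft.2 hx)))
    · exact Finset.inr_mem_disjSum.2 (hi (Finset.mem_union_right _ (Finset.mem_toRight.2 hx)))
  -- Both `v` and `v'` must be the parent of `u`.
  · rintro i (u | u) hu (v | v) hv (v' | v') hv' h1 h2 <;>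
      simp only [Finset.inl_mem_disjSum, Finset.inr_mem_disjSum, hll, hrr, ne_eq,
        not_true_eq_false] at hu hv hv' h1 h2
    · rw [hrl _ _ (hne i u hu v hv)] at h1
      rw [hrl _ _ (hne i u hu v' hv')] at h2
      obtain ⟨k, rfl⟩ := hchild i u hu v hv (.inl h1)
      obtain ⟨k', hk'⟩ := hchild i _ hu v' hv' (.inl h2)
      rw [(List.cons.inj hk').2]
    · rw [hlr _ _ (hne i u hu v hv)] at h1
      rw [hlr _ _ (hne i u hu v' hv')] at h2
      obtain ⟨k, rfl⟩ := hchild i u hu v hv (.inr fun h => h1 (by rw [h, star_zero]))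
      obtain ⟨k', hk'⟩ := hchild i _ hu v' hv' (.inr fun h => h2 (by rw [h, star_zero]))
      rw [(List.cons.inj hk').2]
  · rintro i (v | v) hv <;>
      simp only [Finset.inl_mem_disjSum, Finset.inr_mem_disjSum] at hv
    · have hinj : Function.Injective fun k : ℕ => (Sum.inr (k :: v) : Vertex ⊕ Vertex) :=
        fun a b hab => by simpa using hab
      rw [← hinj.tsum_eq]
      · refine le_trans (le_of_eq (tsum_congr fun k => ?_)) (hbound i v hv 0)
        simp only [Finset.inr_mem_disjSum]
        split_ifs
        · rfl
        · rw [hlr _ _ (by simp), norm_star, limitMatrix_cons_right]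
      · rintro (u | u) hu
        · exact absurd (by simp [hll]) hu
        · by_cases hu' : u ∈ S i
          · exact absurd (by simp [hu']) hu
          · obtain ⟨k, hk⟩ := hchild i u hu' v hv (.inr fun h0 => hu (by
              simp [hlr _ _ (hne i u hu' v hv), h0]))
            exact ⟨k, by rw [hk]⟩
    · have hinj : Function.Injective fun k : ℕ => (Sum.inl (k :: v) : Vertex ⊕ Vertex) :=
        fun a b hab => by simpa using hab
      rw [← hinj.tsum_eq]
      · refine le_trans (le_of_eq (tsum_congr fun k => ?_)) (hbound i v hv 1)
        simp only [Finset.inl_mem_disjSum]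
        split_ifs
        · rfl
        · rw [hrl _ _ (by simp), limitMatrix_cons_left]
      · rintro (u | u) hu
        · by_cases hu' : u ∈ S i
          · exact absurd (by simp [hu']) hu
          · obtain ⟨k, hk⟩ := hchild i u hu' v hv (.inl fun h0 => hu (by
              simp [hrl _ _ (hne i u hu' v hv), h0]))
            exact ⟨k, by rw [hk]⟩
        · exact absurd (by simp [hrr]) hu

/-! ### Finite clusters -/

/-- Starting from `v`, every step of the path to `w ++ v` leads to an offspring whose index belongs
to the set `K u` of the current vertex `u`. -/
def KeptPath (K : Vertex → Set ℕ) (v : Vertex) : List ℕ → Prop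
  | [] => True
  | k :: w => k ∈ K (w ++ v) ∧ KeptPath K v w

/-- For a finite set `F`, take the union of the clusters of all ancestors of elements of `F`. It is
finite and closed under parents, and every edge leaving it is not kept, so the squared weights
leaving it at a vertex sum to at most `∑ f k ^ 2`. -/
theorem selfAdjoint_of_finite_clusters {y : Vertex → ℕ → EuclideanSpace ℂ (Fin 2)}
    {K : Vertex → Set ℕ} {f : ℕ → ℝ} (hf : Summable fun k => f k ^ 2)
    (hK : ∀ v, ∀ k ∉ K v, ‖y v k‖ ≤ f k) (hfin : ∀ v, {w | KeptPath K v w}.Finite) :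
    ∃ h : RowsColumnsL2 (limitMatrix y), ∀ z : ℂ,
      IsSelfAdjoint (bipartization (limitMatrix y) h z) := by
  have hKfin : ∀ v, (K v).Finite := by
    intro v
    have hinj : Function.Injective fun k : ℕ => [k] := fun a b hab => by simpa using hab
    refine ((hfin v).preimage hinj.injOn).subset fun k hk => ?_
    exact ⟨hk, trivial⟩
  have hsum : ∀ v, Summable fun k => ‖y v k‖ ^ 2 := by
    intro v
    refine Summable.of_norm_bounded_eventually hf ?_
    filter_upwards [(hKfin v).compl_mem_cofinite] with k hk
    rw [Real.norm_of_nonneg (by positivity)]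
    exact pow_le_pow_left₀ (norm_nonneg _) (hK v k hk) 2
  -- Words are stored with the last letter first, so the ancestors of `v`, including `v` itself, are
  -- its tails.
  have hTfin : ∀ F : Finset Vertex,
      (⋃ v ∈ F, ⋃ p ∈ v.tails, (· ++ p) '' {w | KeptPath K p w}).Finite := by
    intro F
    refine F.finite_toSet.biUnion fun v _ => ?_
    exact (List.finite_toSet v.tails).biUnion fun p _ => (hfin p).image _
  let S : Finset Vertex → Finset Vertex := fun F => (hTfin F).toFinset
  have hmem : ∀ F x, x ∈ S F ↔ ∃ v ∈ F, ∃ p, p <:+ v ∧ ∃ w, KeptPath K p w ∧ w ++ p = x := by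
    intro F x
    simp [S]
  refine ⟨rowsColumnsL2_limitMatrix hsum, fun z => ?_⟩
  refine isSelfAdjoint_bipartization_limitMatrix (S := S) (l := atTop)
    (tendsto_atTop_mono (fun F v hv => ?_) tendsto_id) ?_ hsum
    (κ := ∑' k, f k ^ 2) (tsum_nonneg fun k => by positivity) ?_ _ z
  · exact (hmem F v).2 ⟨v, hv, v, List.suffix_rfl, [], trivial, rfl⟩
  · intro F k v hv
    rw [hmem] at hv ⊢
    obtain ⟨a, ha, p, hp, w, hw, hwp⟩ := hv
    rcases w with _ | ⟨j, w⟩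
    -- Here the vertex is the starting point of its cluster; its parent is again an ancestor of `a`
    -- and starts a cluster of its own.
    · refine ⟨a, ha, v, ?_, [], trivial, rfl⟩
      have hpk : p = k :: v := hwp
      exact (List.suffix_cons k v).trans (hpk ▸ hp)
    · exact ⟨a, ha, p, hp, w, hw.2, (List.cons.inj hwp).2⟩
  · intro F v hv
    have hle : ∀ k, (if k :: v ∈ S F then 0 else ‖y v k‖ ^ 2) ≤ f k ^ 2 := by
      intro k
      split_ifs with hk
      · positivity
      · refine pow_le_pow_left₀ (norm_nonneg _) (hK v k fun hkK => hk ?_) 2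
        rw [hmem] at hv ⊢
        obtain ⟨a, ha, p, hp, w, hw, rfl⟩ := hv
        exact ⟨a, ha, p, hp, k :: w, ⟨hkK, hw⟩, rfl⟩
    refine Summable.tsum_le_tsum hle (hf.of_nonneg_of_le (fun k => ?_) hle) hf
    split_ifs <;> positivity

/-! ### Subcriticality -/

theorem tsum_pi_prod (q : ℕ → ℝ≥0∞) (n : ℕ) :
    ∑' f : Fin n → ℕ, ∏ i, q (f i) = (∑' k, q k) ^ n := by
  induction n with
  | zero => simp
  | succ n ih =>
    rw [← (Fin.consEquiv fun _ : Fin (n + 1) => ℕ).tsum_eq, ENNReal.tsum_prod', pow_succ', ← ih,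
      ← ENNReal.tsum_mul_right]
    refine tsum_congr fun k => ?_
    rw [← ENNReal.tsum_mul_left]
    refine tsum_congr fun f => ?_
    simp [Fin.prod_univ_succ, Fin.consEquiv]

/-- Sorting words by length gives the geometric series of generation sizes, which bounds the
expected size of a cluster. -/
theorem tsum_list_prod (q : ℕ → ℝ≥0∞) :
    ∑' w : List ℕ, (w.map q).prod = ∑' n, (∑' k, q k) ^ n := by
  rw [← List.equivSigmaTuple.symm.tsum_eq, ENNReal.tsum_sigma']
  refine tsum_congr fun n => ?_
  rw [← tsum_pi_prod]
  refine tsum_congr fun f => ?_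
  simp [List.equivSigmaTuple, List.prod_ofFn, List.map_ofFn]

section Independence

variable {Ω X : Type*} [MeasurableSpace X] {Ξ : Vertex → Ω → X} {D : ℕ → Set X}

/-- Each step of the path is decided at the vertex it departs from, so the endpoint `w ++ v` is
never consulted. The strict inequality of lengths makes the next step independent of the past. -/
theorem measurableSet_keptPath (hD : ∀ k, MeasurableSet (D k)) (v : Vertex) (w : List ℕ) :
    MeasurableSet[⨆ u ∈ {u : Vertex | u.length < (w ++ v).length},
      MeasurableSpace.comap (Ξ u) inferInstance]
      {ω | KeptPath (fun u => {k | Ξ u ω ∈ D k}) v w} := by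
  induction w with
  | nil => exact @MeasurableSet.univ _ (_)
  | cons k w ih =>
    have h1 : {ω | KeptPath (fun u => {k | Ξ u ω ∈ D k}) v (k :: w)} =
      Ξ (w ++ v) ⁻¹' D k ∩ {ω | KeptPath (fun u => {k | Ξ u ω ∈ D k}) v w} := rfl
    rw [h1]
    refine @MeasurableSet.inter _ (_) _ _ ?_ ?_
    · refine MeasurableSpace.le_def.1 (le_biSup (fun u : Vertex =>
        MeasurableSpace.comap (Ξ u) inferInstance) (i := w ++ v) ?_) _ ⟨D k, hD k, rfl⟩
      simp
    · refine MeasurableSpace.le_def.1 (biSup_mono fun u hu => ?_) _ ih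
      simp only [Set.mem_ofPred_eq, List.cons_append, List.length_cons] at hu ⊢
      omega

variable [MeasurableSpace Ω] {P : Measure Ω}

theorem measure_keptPath_le (hΞ : ∀ v, Measurable (Ξ v)) (hind : iIndepFun Ξ P)
    (hD : ∀ k, MeasurableSet (D k)) {q : ℕ → ℝ≥0∞} (hq : ∀ v k, P (Ξ v ⁻¹' D k) ≤ q k)
    (v : Vertex) (w : List ℕ) :
    P {ω | KeptPath (fun u => {k | Ξ u ω ∈ D k}) v w} ≤ (w.map q).prod := by
  have := hind.isProbabilityMeasure
  induction w with
  | nil => simpa using prob_le_one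
  | cons k w ih =>
    have h1 : {ω | KeptPath (fun u => {k | Ξ u ω ∈ D k}) v (k :: w)} =
      Ξ (w ++ v) ⁻¹' D k ∩ {ω | KeptPath (fun u => {k | Ξ u ω ∈ D k}) v w} := rfl
    have hdisj : Disjoint {w ++ v} {u : Vertex | u.length < (w ++ v).length} := by
      rw [Set.disjoint_singleton_left]
      simp
    have hindep := indep_iSup_of_disjoint (fun u => (hΞ u).comap_le)
      ((iIndepFun_iff_iIndep _ _ _).1 hind) hdisj
    rw [iSup_singleton, Indep_iff] at hindep
    rw [h1, hindep _ _ ⟨D k, hD k, rfl⟩ (measurableSet_keptPath hD v w), List.map_cons,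
      List.prod_cons]
    gcongr
    exact hq _ k

/-- The first Borel–Cantelli lemma over all words `w`: the probabilities sum to at most `∑ (∑ q k) ^
n`, which is finite in the subcritical case. -/
theorem ae_finite_keptPath (hΞ : ∀ v, Measurable (Ξ v)) (hind : iIndepFun Ξ P)
    (hD : ∀ k, MeasurableSet (D k)) {q : ℕ → ℝ≥0∞} (hq : ∀ v k, P (Ξ v ⁻¹' D k) ≤ q k)
    (hsub : ∑' k, q k < 1) :
    ∀ᵐ ω ∂P, ∀ v, {w | KeptPath (fun u => {k | Ξ u ω ∈ D k}) v w}.Finite := by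
  refine ae_all_iff.2 fun v => ?_
  refine ae_finite_setOfPred_mem (s := fun w => {ω | KeptPath (fun u => {k | Ξ u ω ∈ D k}) v w}) ?_
  refine ne_top_of_le_ne_top ?_
    (ENNReal.tsum_le_tsum fun w => measure_keptPath_le hΞ hind hD hq v w)
  rw [tsum_list_prod, ENNReal.tsum_geometric]
  simpa [tsub_eq_zero_iff_le] using hsub

end Independence

/-! ### Poisson estimates -/

-- Since `n! i! ≤ (n + i)!`, the Poisson weight at `n + i` is at most `r ^ n / n!` times the weight
-- at `i`, and the latter weights sum to one.
open scoped Nat in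
theorem poissonMeasure_Ici_le (r : NNReal) (n : ℕ) :
    poissonMeasure r (Set.Ici n) ≤ ENNReal.ofReal ((r : ℝ) ^ n / n !) := by
  have h1 : Set.Ici n = ⋃ i : ℕ, {n + i} := by
    ext j
    simp only [Set.mem_Ici, Set.mem_iUnion, Set.mem_singleton_iff]
    exact le_iff_exists_add
  have h2 : ∀ i : ℕ, poissonMeasure r {n + i} ≤
      ENNReal.ofReal ((r : ℝ) ^ n / n !) * poissonMeasure r {i} := by
    intro i
    rw [poissonMeasure_singleton, poissonMeasure_singleton, ← ENNReal.ofReal_mul (by positivity)]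
    refine ENNReal.ofReal_le_ofReal ?_
    have h3 : ((n ! * i ! : ℕ) : ℝ) ≤ ((n + i)! : ℕ) := by
      exact_mod_cast Nat.le_of_dvd (Nat.factorial_pos _)
        (Nat.factorial_mul_factorial_dvd_factorial_add n i)
    calc Real.exp (-r) * (r : ℝ) ^ (n + i) / (n + i)!
        ≤ Real.exp (-r) * (r : ℝ) ^ (n + i) / ((n ! * i ! : ℕ) : ℝ) := by gcongr
      _ = (r : ℝ) ^ n / n ! * (Real.exp (-r) * (r : ℝ) ^ i / i !) := by
        push_cast
        field_simp
        ring
  calc poissonMeasure r (Set.Ici n) ≤ ∑' i : ℕ, poissonMeasure r {n + i} := by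
        rw [h1]
        exact measure_iUnion_le _
    _ ≤ ∑' i : ℕ, ENNReal.ofReal ((r : ℝ) ^ n / n !) * poissonMeasure r {i} :=
        ENNReal.tsum_le_tsum h2
    _ = ENNReal.ofReal ((r : ℝ) ^ n / n !) * poissonMeasure r (⋃ i : ℕ, {i}) := by
        rw [ENNReal.tsum_mul_left, measure_iUnion (fun i j hij => by simpa using hij)
          fun i => measurableSet_singleton i]
    _ = ENNReal.ofReal ((r : ℝ) ^ n / n !) := by
        rw [Set.iUnion_of_singleton, measure_univ, mul_one]

/-- The mean is at most `c n`, so the tail is at most `(c n) ^ n / n!`, and `n ^ n / n! ≤ e ^ n`.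
The bound is useful when `c e < 1`. -/
theorem IsPoissonPointProcess.measure_natCast_le_le {Ω E : Type*} [MeasurableSpace Ω]
    [MeasurableSpace E] {N : Ω → Measure E} {ρ : Measure E} {P : Measure Ω}
    (hN : IsPoissonPointProcess N ρ P) {A : Set E} (hA : MeasurableSet A) {c : ℝ} (hc : 0 ≤ c)
    (n : ℕ) (hρ : ρ A ≤ ENNReal.ofReal (c * n)) :
    P {ω | (n : ℝ≥0∞) ≤ N ω A} ≤ ENNReal.ofReal (c * Real.exp 1) ^ n := by
  have hfin : ρ A < ∞ := hρ.trans_lt ENNReal.ofReal_lt_top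
  have hmeas : Measurable fun ω => N ω A := (Measure.measurable_coe hA).comp hN.measurable
  have h1 : P {ω | (n : ℝ≥0∞) ≤ N ω A} = P.map (fun ω => N ω A) (Set.Ici (n : ℝ≥0∞)) := by
    rw [Measure.map_apply hmeas measurableSet_Ici]
    rfl
  have h2 : (fun j : ℕ => (j : ℝ≥0∞)) ⁻¹' Set.Ici (n : ℝ≥0∞) = Set.Ici n := by
    ext j
    simp
  have h3 : ((ρ A).toNNReal : ℝ) ≤ c * n := ENNReal.toReal_le_of_le_ofReal (by positivity) hρ
  rw [h1, hN.law_of_lt_top A hA hfin, Measure.map_apply .of_discrete measurableSet_Ici, h2,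
    ← ENNReal.ofReal_pow (by positivity)]
  refine (poissonMeasure_Ici_le _ n).trans (ENNReal.ofReal_le_ofReal ?_)
  calc ((ρ A).toNNReal : ℝ) ^ n / (Nat.factorial n : ℝ) ≤ (c * n) ^ n / (Nat.factorial n : ℝ) := by
        gcongr
    _ = c ^ n * ((n : ℝ) ^ n / (Nat.factorial n : ℝ)) := by rw [mul_pow, mul_div_assoc]
    _ ≤ c ^ n * Real.exp n := by
        gcongr
        exact Real.pow_div_factorial_le_exp _ (by positivity) n
    _ = (c * Real.exp 1) ^ n := by rw [mul_pow, ← Real.exp_nat_mul, mul_one]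

theorem mAlpha_Ioi {α : ℝ} (hα : 0 < α) {r : ℝ} (hr : 0 < r) :
    mAlpha α (Set.Ioi r) = ENNReal.ofReal (r ^ (-α)) := by
  have hlt : -(1 + α) < -1 := by linarith
  have hint : IntegrableOn (fun t : ℝ => α * t ^ (-(1 + α))) (Set.Ioi r) :=
    (integrableOn_Ioi_rpow_of_lt hlt hr).const_mul α
  rw [mAlpha, withDensity_apply _ measurableSet_Ioi, Measure.restrict_restrict measurableSet_Ioi,
    Set.inter_eq_left.2 (Set.Ioi_subset_Ioi hr.le), ← ofReal_integral_eq_lintegral_ofReal hint,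
    integral_const_mul, integral_Ioi_rpow_of_lt hlt hr]
  · congr 1
    rw [show -(1 + α) + 1 = -α by ring]
    field_simp
  · filter_upwards [self_mem_ae_restrict measurableSet_Ioi] with t ht
    have : 0 < t := hr.trans ht
    positivity

theorem polarMeasure_norm_gt (θ : Measure (Metric.sphere (0 : EuclideanSpace ℂ (Fin 2)) 1))
    [IsFiniteMeasure θ] {α : ℝ} (hα : 0 < α) {r : ℝ} (hr : 0 < r) :
    polarMeasure θ α {x | r < ‖x‖} = θ Set.univ * ENNReal.ofReal (r ^ (-α)) := by
  have : SFinite (mAlpha α) := by unfold mAlpha; infer_instance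
  have hm : MeasurableSet {x : EuclideanSpace ℂ (Fin 2) | r < ‖x‖} :=
    measurableSet_lt measurable_const measurable_norm
  have hpre : (fun p : Metric.sphere (0 : EuclideanSpace ℂ (Fin 2)) 1 × ℝ =>
      p.2 • (p.1 : EuclideanSpace ℂ (Fin 2))) ⁻¹' {x | r < ‖x‖} =
      Set.univ ×ˢ {t | r < |t|} := by
    ext ⟨w, t⟩
    simp [norm_smul]
  -- The radial variable formally ranges over `ℝ`, so the norm is `|t|`; nonpositive `t` carry no
  -- mass.
  have hneg : mAlpha α (Set.Iic 0) = 0 := by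
    rw [mAlpha, withDensity_apply _ measurableSet_Iic, Measure.restrict_restrict measurableSet_Iic,
      show Set.Iic (0 : ℝ) ∩ Set.Ioi 0 = ∅ by ext; simp]
    simp
  have habs : mAlpha α {t | r < |t|} = mAlpha α (Set.Ioi r) := by
    refine measure_congr ?_
    have h0 : ∀ᵐ t ∂mAlpha α, t ∉ Set.Iic (0 : ℝ) := measure_eq_zero_iff_ae_notMem.1 hneg
    filter_upwards [h0] with t ht
    have ht' : 0 < t := by simpa using ht
    change (r < |t|) = (r < t)
    rw [abs_of_pos ht']
  rw [polarMeasure, Measure.map_apply (by fun_prop) hm, hpre, Measure.prod_prod, habs,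
    mAlpha_Ioi hα hr]

/-! ### The Poisson weighted infinite tree -/

/-- The points with indices `0, …, k` all have norm at least `‖y k‖`. This replaces a condition on
the single point `y k` by one on the point measure, the object whose independence and law are given.
-/
theorem natCast_add_one_le_pointMeasure {E : Type*} [NormedAddCommGroup E] [MeasurableSpace E]
    [OpensMeasurableSpace E] {y : ℕ → E} (hy : Antitone fun k => ‖y k‖) {r : ℝ} {k : ℕ}
    (hk : r < ‖y k‖) : ((k + 1 : ℕ) : ℝ≥0∞) ≤ pointMeasure y {x | r < ‖x‖} := by
  have hm : MeasurableSet {x : E | r < ‖x‖} := measurableSet_lt measurable_const measurable_norm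
  rw [pointMeasure, Measure.sum_apply _ hm]
  refine le_trans ?_ (ENNReal.sum_le_tsum (Finset.range (k + 1)))
  rw [Finset.sum_congr rfl (g := fun _ => (1 : ℝ≥0∞))]
  · simp
  · intro j hj
    rw [Measure.dirac_apply' _ hm, Set.indicator_of_mem]
    · rfl
    · exact hk.trans_le (hy (Nat.lt_succ_iff.1 (Finset.mem_range.1 hj)))

end HeavyElliptic

open HeavyElliptic

theorem proposition4p2 {Ω : Type*} [MeasurableSpace Ω] (P : MeasureTheory.Measure Ω)
    [MeasureTheory.IsProbabilityMeasure P] (α : ℝ) (hα₀ : 0 < α) (hα₂ : α < 2)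
    (θ : MeasureTheory.Measure (Metric.sphere (0 : EuclideanSpace ℂ (Fin 2)) 1))
    [MeasureTheory.IsFiniteMeasure θ] (hθ : θ ≠ 0)
    (y : HeavyElliptic.Vertex → ℕ → Ω → EuclideanSpace ℂ (Fin 2))
    (hy : HeavyElliptic.IsPWIT y (HeavyElliptic.polarMeasure θ α) P) :
    ∀ᵐ ω ∂P, ∃ h : HeavyElliptic.RowsColumnsL2 (HeavyElliptic.limitMatrix fun v k => y v k ω),
      ∀ z : ℂ, IsSelfAdjoint
        (HeavyElliptic.bipartization (HeavyElliptic.limitMatrix fun v k => y v k ω) h z) := by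
  let T : ℝ := (θ Set.univ).toReal + 1
  have hT : 0 < T := by positivity
  -- Chosen so that `ρ {‖x‖ > f k} ≤ (k + 1) / (3e)`. The tail bound then gives `3^(-(k+1))`, with
  -- sum `1/2`; any constant above `2` in place of `3` would keep the sum below `1`.
  let R : ℝ := (3 * Real.exp 1 * T) ^ (1 / α)
  have hR : 0 < R := by positivity
  have hRα : R ^ (-α) = (3 * Real.exp 1 * T)⁻¹ := by
    rw [← Real.rpow_mul (by positivity), show 1 / α * -α = -1 by field_simp, Real.rpow_neg_one]
  let f : ℕ → ℝ := fun k => R * ((k + 1 : ℕ) : ℝ) ^ (-(1 / α))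
  have hf : ∀ k, 0 < f k := fun k => by positivity
  have hfα : ∀ k, f k ^ (-α) = (3 * Real.exp 1 * T)⁻¹ * ((k + 1 : ℕ) : ℝ) := by
    intro k
    rw [Real.mul_rpow hR.le (by positivity), hRα, ← Real.rpow_mul (by positivity),
      show -(1 / α) * -α = 1 by field_simp, Real.rpow_one]
  have hfsum : Summable fun k => f k ^ 2 := by
    have h1 : Summable fun k : ℕ => R ^ 2 * ((k + 1 : ℕ) : ℝ) ^ (-(2 / α)) := by
      refine Summable.mul_left _ ((summable_nat_add_iff 1).2 (Real.summable_nat_rpow.2 ?_))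
      -- The exponent `2 / α` exceeds `1` precisely because `α < 2`.
      rw [neg_lt_neg_iff, lt_div_iff₀ hα₀]
      linarith
    refine h1.congr fun k => ?_
    rw [mul_pow, ← Real.rpow_natCast (((k + 1 : ℕ) : ℝ) ^ (-(1 / α))),
      ← Real.rpow_mul (by positivity)]
    congr 2
    push_cast
    ring
  let c : ℝ := (3 * Real.exp 1)⁻¹
  have hρ : ∀ k, polarMeasure θ α {x | f k < ‖x‖} ≤ ENNReal.ofReal (c * (k + 1 : ℕ)) := by
    intro k
    rw [polarMeasure_norm_gt θ hα₀ (hf k), hfα,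
      ← ENNReal.ofReal_toReal (measure_ne_top θ Set.univ), ← ENNReal.ofReal_mul (by positivity)]
    refine ENNReal.ofReal_le_ofReal ?_
    have h1 : (θ Set.univ).toReal * T⁻¹ ≤ 1 := by
      rw [mul_inv_le_iff₀ hT]
      simp [T]
    calc (θ Set.univ).toReal * ((3 * Real.exp 1 * T)⁻¹ * ((k + 1 : ℕ) : ℝ))
        = ((θ Set.univ).toReal * T⁻¹) * (c * (k + 1 : ℕ)) := by
          simp only [c, mul_inv]
          ring
      _ ≤ 1 * (c * (k + 1 : ℕ)) := by gcongr
      _ = c * (k + 1 : ℕ) := one_mul _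
  have hm : ∀ k, MeasurableSet {x : EuclideanSpace ℂ (Fin 2) | f k < ‖x‖} := fun k =>
    measurableSet_lt measurable_const measurable_norm
  -- Being kept is defined through the count of points of `Ξ_v` rather than through `‖y v k‖`, so
  -- that it is an event of `Ξ_v` alone.
  have hfin := ae_finite_keptPath
    (D := fun k => {ν : Measure (EuclideanSpace ℂ (Fin 2)) |
      ((k + 1 : ℕ) : ℝ≥0∞) ≤ ν {x | f k < ‖x‖}})
    (q := fun k => ENNReal.ofReal (c * Real.exp 1) ^ (k + 1))
    (fun v => (hy.poisson v).measurable) hy.indep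
    (fun k => measurableSet_le measurable_const (Measure.measurable_coe (hm k)))
    (fun v k => (hy.poisson v).measure_natCast_le_le (hm k) (by positivity) (k + 1) (hρ k)) ?_
  · filter_upwards [hfin, ae_all_iff.2 hy.antitone] with ω hω hanti
    refine selfAdjoint_of_finite_clusters hfsum (fun v k hk => ?_) hω
    by_contra hlt
    exact hk (natCast_add_one_le_pointMeasure (hanti v) (not_le.1 hlt))
  · have h1 : c * Real.exp 1 = 3⁻¹ := by
      simp only [c]
      field_simp
    rw [ENNReal.tsum_geometric_add_one, h1, ← ENNReal.ofReal_one,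
      ← ENNReal.ofReal_sub _ (by norm_num), ← ENNReal.ofReal_inv_of_pos (by norm_num),
      ← ENNReal.ofReal_mul (by norm_num), ENNReal.ofReal_lt_ofReal_iff one_pos]
    norm_num
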